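/- Conventions. A lattice polytope $P\subset\mathbb R^d$ (the convex hull of a finite nonempty set, with all vertices in $\mathbb Z^d$) is called smooth if every vertex $v$ has exactly $d$ adjacent vertices $w_1,\dots,w_d$ and the primitive edge directions $(w_i-v)/\gcd(w_i-v)$ have determinant $\pm1$; such a $P$ is $d$-dimensional. Its normal fan $F$ consists of the normal cones $\{c\in\mathbb R^d : \langle c,y\rangle\le\langle c,x\rangle \text{ for all } x\in G,\ y\in P\}$ of the nonempty faces $G$ of $P$ (including $P$ itself), and $F^{(k)}$ denotes the set of $k$-dimensional cones of $F$. For a ray $r\in F^{(1)}$ let $k_r$ be the number of full-dimensional cones of $F$ containing $r$, and let $k_F=\max_{r\in F^{(1)}}k_r$. For natural numbers $N,k$ let $\mathcal P_N(k)$ be the set of smooth lattice polygons $Q\subset\mathbb R^2$ with exactly $k$ vertices and at most $N$ lattice points, and put $$i_N(k)=\min_{Q\in\mathcal P_N(k)}|\operatorname{int}(Q)\cap\mathbb Z^2|,\qquad b_N(k)=\min_{Q\in\mathcal P_N(k)}\bigl(|Q\cap\mathbb Z^2|-|\operatorname{int}(Q)\cap\mathbb Z^2|\bigr)$$ whenever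 $\mathcal P_N(k)\neq\emptyset$. Lemma (smooth lattice polygon criterion). Let $P\subset\mathbb R^3$ be a smooth lattice $3$-polytope with normal fan $F$, and let $N$ be a natural number such that every facet of $P$ contains at most $N$ lattice points (for example any $N\ge|P\cap\mathbb Z^3|$). Then $F$ is finite, $F^{(1)}$ is nonempty, $\mathcal P_N(k_r)\neq\emptyset$ for every ray $r\in F^{(1)}$ (so all the minima below exist), and $$|P\cap\mathbb Z^3|\ \ge\ |F^{(3)}|+\bigl(b_N(k_F)-k_F\bigr)+\sum_{r\in F^{(1)}}i_N(k_r).$$ -/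

import Mathlib

namespace LatticePolytope

/-- The integer vector `z`, seen as a point of `ℝ^d`. -/
def toReal {d : ℕ} (z : Fin d → ℤ) : Fin d → ℝ := fun i => (z i : ℝ)

/-- The lattice `ℤ^d` inside `ℝ^d`. -/
def lattice (d : ℕ) : Set (Fin d → ℝ) := Set.range toReal

/-- A polytope: the convex hull of a finite set of points. -/
def IsPolytope {d : ℕ} (P : Set (Fin d → ℝ)) : Prop :=
  ∃ V : Set (Fin d → ℝ), V.Finite ∧ P = convexHull ℝ V

/-- The vertices of a polytope. -/
def vertices {d : ℕ} (P : Set (Fin d → ℝ)) : Set (Fin d → ℝ) := P.extremePoints ℝ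

/-- `G` is a nonempty face of `P`: the set of points of `P` at which some linear functional
is maximal (the zero functional gives `P` itself). -/
def IsFace {d : ℕ} (P G : Set (Fin d → ℝ)) : Prop := G.Nonempty ∧ IsExposed ℝ P G

/-- The dimension of (the affine hull of) a nonempty set. -/
noncomputable def affDim {d : ℕ} (G : Set (Fin d → ℝ)) : ℕ :=
  Module.finrank ℝ (vectorSpan ℝ G)

/-- The vertices adjacent to the vertex `v`: those other vertices that lie with `v` on an edge. -/
def neighbors {d : ℕ} (P : Set (Fin d → ℝ)) (v : Fin d → ℝ) : Set (Fin d → ℝ) :=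
  {w | w ∈ vertices P ∧ w ≠ v ∧ ∃ G, IsFace P G ∧ affDim G = 1 ∧ v ∈ G ∧ w ∈ G}

/-- An integer vector divided by the gcd of its coordinates. -/
def primitive {d : ℕ} (z : Fin d → ℤ) : Fin d → ℤ := fun i => z i / Finset.univ.gcd z

/-- A (nonempty) smooth lattice polytope in `ℝ^d`: the vertices are integral, every vertex has
exactly `d` neighbours, and at every vertex the primitive edge directions have determinant `±1`.
Such a polytope is automatically `d`-dimensional. -/
structure IsSmooth {d : ℕ} (P : Set (Fin d → ℝ)) : Prop where
  nonempty : P.Nonempty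
  isPolytope : IsPolytope P
  lattice : vertices P ⊆ lattice d
  simple : ∀ v ∈ vertices P, (neighbors P v).ncard = d
  smooth : ∀ v : Fin d → ℤ, toReal v ∈ vertices P →
    ∃ w : Fin d → (Fin d → ℤ), Set.range (fun i => toReal (w i)) = neighbors P (toReal v) ∧
      ((Matrix.of fun i => primitive (w i - v)).det = 1 ∨
        (Matrix.of fun i => primitive (w i - v)).det = -1)

/-- The (outer) normal cone of `P` at a face `G`: the vectors `c` such that the functional
`⟨c, ·⟩` attains its maximum over `P` at every point of `G`. -/
def normalCone {d : ℕ} (P G : Set (Fin d → ℝ)) : Set (Fin d → ℝ) :=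
  {c | ∀ x ∈ G, ∀ y ∈ P, c ⬝ᵥ y ≤ c ⬝ᵥ x}

/-- The normal fan of `P`: the normal cones of all nonempty faces. -/
def normalFan {d : ℕ} (P : Set (Fin d → ℝ)) : Set (Set (Fin d → ℝ)) :=
  {C | ∃ G, IsFace P G ∧ C = normalCone P G}

/-- `F^{(k)}`: the cones of `F` of dimension `k`. -/
def conesOfDim {d : ℕ} (F : Set (Set (Fin d → ℝ))) (k : ℕ) : Set (Set (Fin d → ℝ)) :=
  {C | C ∈ F ∧ Module.finrank ℝ (Submodule.span ℝ C) = k}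

/-- `k_r`: the number of full-dimensional cones of `F` containing the ray `r`. -/
noncomputable def rayDegree {d : ℕ} (F : Set (Set (Fin d → ℝ))) (r : Set (Fin d → ℝ)) : ℕ :=
  {C | C ∈ conesOfDim F d ∧ r ⊆ C}.ncard

/-- `k_F`: the maximum of `k_r` over all rays `r` of `F`. -/
noncomputable def maxRayDegree {d : ℕ} (F : Set (Set (Fin d → ℝ))) : ℕ :=
  sSup (rayDegree F '' conesOfDim F 1)

/-- The number of lattice points in a bounded set. -/
noncomputable def numLatticePoints {d : ℕ} (S : Set (Fin d → ℝ)) : ℕ := (S ∩ lattice d).ncard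

/-- The set of all smooth lattice `k`-gons with at most `N` lattice points. -/
def smoothPolygons (N k : ℕ) : Set (Set (Fin 2 → ℝ)) :=
  {Q | IsSmooth Q ∧ (vertices Q).ncard = k ∧ numLatticePoints Q ≤ N}

/-- `i_N(k)`: the minimal number of interior lattice points of a polygon in
`smoothPolygons N k` (meaningful when that set is nonempty). -/
noncomputable def minInterior (N k : ℕ) : ℕ :=
  sInf ((fun Q => numLatticePoints (interior Q)) '' smoothPolygons N k)

/-- `b_N(k)`: the minimal number of boundary lattice points of a polygon in
`smoothPolygons N k` (meaningful when that set is nonempty). -/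
noncomputable def minBoundary (N k : ℕ) : ℕ :=
  sInf ((fun Q => numLatticePoints Q - numLatticePoints (interior Q)) '' smoothPolygons N k)

end LatticePolytope

namespace LatticePolytope

/-! Taking normal cones reverses inclusion and complements dimension, so rays of the fan are facets
of `P`, full-dimensional cones are vertices, and the degree of a ray is the number of vertices of
its facet (`span_normalCone`, `rayDegree_normalCone`).

Each facet is a smooth polygon in suitable lattice coordinates (`IsSmooth.exists_chart`). The
primitive edge directions at a vertex form a basis of the lattice, and a facet through it contains
all neighbours but one; the remaining directions give the chart. At any other vertex of the facet,
the unimodular change of basis has a zero column on the edges inside the facet, apart from the entry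
of the one outside edge, so the complementary minor is a unit (`IsEdgeFrame.isSmooth_preimage`).
This rests on the fact that `P` lies in the cone spanned by its edges at each vertex
(`IsPolytope.dotProduct_le_of_neighbors`, `IsEdgeFrame.coord_nonneg`).

Hence every facet has at least `minInterior` relatively interior lattice points, and a facet with
the most vertices has at least `minBoundary` boundary ones. Vertices of `P`, relative interiors of
the facets, and non-vertex boundary points of that one facet are pairwise disjoint; adding them up
gives the bound (`vertices_add_boundary_add_sum_relInterior_le`). -/

variable {d : ℕ}

/-! ### Faces of polytopes as maximal sets of functionals -/

/-- The points of `P` at which the functional `⟨c, ·⟩` is maximal. -/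
def maxFace (P : Set (Fin d → ℝ)) (c : Fin d → ℝ) : Set (Fin d → ℝ) :=
  {x ∈ P | ∀ y ∈ P, c ⬝ᵥ y ≤ c ⬝ᵥ x}

/-- The continuous linear functional `⟨c, ·⟩`. -/
noncomputable def dotCLM (c : Fin d → ℝ) : StrongDual ℝ (Fin d → ℝ) :=
  LinearMap.toContinuousLinearMap (dotProductEquiv ℝ (Fin d) c)

lemma exists_dotProduct_eq (l : Module.Dual ℝ (Fin d → ℝ)) :
    ∃ c : Fin d → ℝ, ∀ x, l x = c ⬝ᵥ x := by
  obtain ⟨c, rfl⟩ := (dotProductEquiv ℝ (Fin d)).surjective l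
  exact ⟨c, fun x => rfl⟩

lemma isExposed_maxFace (P : Set (Fin d → ℝ)) (c : Fin d → ℝ) : IsExposed ℝ P (maxFace P c) :=
  ContinuousLinearMap.toExposed.isExposed (l := dotCLM c)

lemma isFace_iff {P G : Set (Fin d → ℝ)} :
    IsFace P G ↔ G.Nonempty ∧ ∃ c, G = maxFace P c := by
  constructor
  · rintro ⟨hG, h⟩
    obtain ⟨l, hl⟩ := h hG
    obtain ⟨c, hc⟩ := exists_dotProduct_eq l.toLinearMap
    refine ⟨hG, c, ?_⟩
    rw [hl]
    ext x
    simp only [maxFace, Set.mem_ofPred_eq, ← hc]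
    rfl
  · rintro ⟨hG, c, rfl⟩
    exact ⟨hG, isExposed_maxFace P c⟩

lemma maxFace_subset (P : Set (Fin d → ℝ)) (c : Fin d → ℝ) : maxFace P c ⊆ P := fun _ h => h.1

lemma mem_maxFace_iff {P : Set (Fin d → ℝ)} {c g x : Fin d → ℝ} (hg : g ∈ maxFace P c) :
    x ∈ maxFace P c ↔ x ∈ P ∧ c ⬝ᵥ x = c ⬝ᵥ g :=
  ⟨fun h => ⟨h.1, le_antisymm (hg.2 _ h.1) (h.2 _ hg.1)⟩,
    fun h => ⟨h.1, fun y hy => h.2 ▸ hg.2 y hy⟩⟩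

lemma convex_dotProduct_le (c : Fin d → ℝ) (M : ℝ) : Convex ℝ {x | c ⬝ᵥ x ≤ M} :=
  convex_halfSpace_le (dotProductEquiv ℝ (Fin d) c).isLinear M

lemma dotProduct_le_of_mem_convexHull {S : Set (Fin d → ℝ)} {c x : Fin d → ℝ} {M : ℝ}
    (h : ∀ y ∈ S, c ⬝ᵥ y ≤ M) (hx : x ∈ convexHull ℝ S) : c ⬝ᵥ x ≤ M :=
  convexHull_min (t := {x | c ⬝ᵥ x ≤ M}) h (convex_dotProduct_le c M) hx

namespace IsPolytope

variable {P G : Set (Fin d → ℝ)}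

lemma isCompact (hP : IsPolytope P) : IsCompact P := by
  obtain ⟨V, hV, rfl⟩ := hP
  exact hV.isCompact_convexHull ℝ

lemma convex (hP : IsPolytope P) : Convex ℝ P := by
  obtain ⟨V, hV, rfl⟩ := hP
  exact convex_convexHull ℝ V

lemma finite_vertices (hP : IsPolytope P) : (vertices P).Finite := by
  obtain ⟨V, hV, rfl⟩ := hP
  exact hV.subset extremePoints_convexHull_subset

lemma convexHull_vertices (hP : IsPolytope P) : convexHull ℝ (vertices P) = P := by
  conv_rhs => rw [← closure_convexHull_extremePoints hP.isCompact hP.convex]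
  exact (hP.finite_vertices.isClosed_convexHull ℝ).closure_eq.symm

lemma vertices_nonempty (hP : IsPolytope P) (h : P.Nonempty) : (vertices P).Nonempty :=
  hP.isCompact.extremePoints_nonempty h

end IsPolytope

lemma vertices_subset (P : Set (Fin d → ℝ)) : vertices P ⊆ P := extremePoints_subset

namespace IsFace

variable {P G : Set (Fin d → ℝ)}

lemma subset (h : IsFace P G) : G ⊆ P := h.2.subset

lemma vertices_eq (h : IsFace P G) : vertices G = G ∩ vertices P :=
  h.2.isExtreme.extremePoints_eq

lemma eq_convexHull (h : IsFace P G) (hP : IsPolytope P) :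
    G = convexHull ℝ (G ∩ vertices P) := by
  rw [← h.vertices_eq]
  conv_lhs => rw [← closure_convexHull_extremePoints (h.2.isCompact hP.isCompact)
    (h.2.convex hP.convex)]
  refine IsClosed.closure_eq (Set.Finite.isClosed_convexHull ℝ ?_)
  exact (hP.finite_vertices.inter_of_right G).subset h.vertices_eq.le

lemma isPolytope (h : IsFace P G) (hP : IsPolytope P) : IsPolytope G :=
  ⟨_, hP.finite_vertices.inter_of_right G, h.eq_convexHull hP⟩

end IsFace

/-- A face is the hull of the vertices it contains, hence is determined by a subset of a finite set.
-/
lemma IsPolytope.finite_faces {P : Set (Fin d → ℝ)} (hP : IsPolytope P) :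
    {G | IsFace P G}.Finite := by
  refine Set.Finite.of_finite_image (f := fun G => G ∩ vertices P)
    (hP.finite_vertices.finite_subsets.subset ?_) ?_
  · rintro _ ⟨G, -, rfl⟩
    exact Set.inter_subset_right
  · intro G hG G' hG' h
    rw [IsFace.eq_convexHull hG hP, IsFace.eq_convexHull hG' hP]
    exact congrArg _ h

lemma maxFace_nonempty {P : Set (Fin d → ℝ)} (hP : IsPolytope P) (h : P.Nonempty)
    (c : Fin d → ℝ) : (maxFace P c).Nonempty := by
  obtain ⟨x, hx, hmax⟩ := hP.isCompact.exists_isMaxOn h (dotCLM c).continuous.continuousOn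
  exact ⟨x, hx, fun y hy => hmax hy⟩

lemma isFace_maxFace {P : Set (Fin d → ℝ)} (hP : IsPolytope P) (h : P.Nonempty)
    (c : Fin d → ℝ) : IsFace P (maxFace P c) :=
  ⟨maxFace_nonempty hP h c, isExposed_maxFace P c⟩

/-- A polytope on whose vertices `⟨c, ·⟩` is maximal only at vertices in the convex set `G`
has its maximal face inside `G`. -/
lemma maxFace_subset_of_vertices {P G : Set (Fin d → ℝ)} (hP : IsPolytope P)
    (hG : Convex ℝ G) {c : Fin d → ℝ} (h : ∀ v ∈ vertices P, v ∈ maxFace P c → v ∈ G) :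
    maxFace P c ⊆ G := by
  rcases (maxFace P c).eq_empty_or_nonempty with h0 | h0
  · simp [h0]
  rw [IsFace.eq_convexHull ⟨h0, isExposed_maxFace P c⟩ hP]
  exact convexHull_min (fun v hv => h v hv.2 hv.1) hG

/-- Perturbing the functional that cuts out a face cuts out a face of that face. -/
lemma exists_maxFace_maxFace {P : Set (Fin d → ℝ)} (hP : IsPolytope P) (h : P.Nonempty)
    (c u : Fin d → ℝ) : ∃ ε : ℝ, 0 < ε ∧ maxFace P (c + ε • u) = maxFace (maxFace P c) u := by
  have hF := isFace_maxFace hP h c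
  have hF' := isFace_maxFace (hF.isPolytope hP) hF.1 u
  obtain ⟨g, hg⟩ := hF'.1
  -- Vertices off the face have a strict gap in `c`, which survives small perturbations; as they are
  -- finitely many, one `ε` serves them all.
  have hev : ∀ v ∈ vertices P \ maxFace P c, ∀ᶠ ε in nhdsWithin (0 : ℝ) (Set.Ioi 0),
      (c + ε • u) ⬝ᵥ v < (c + ε • u) ⬝ᵥ g := by
    rintro v ⟨hv, hvc⟩
    have hlt : c ⬝ᵥ v < c ⬝ᵥ g := by
      refine lt_of_le_of_ne (hg.1.2 v (vertices_subset P hv)) fun he => hvc ?_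
      exact (mem_maxFace_iff hg.1).2 ⟨vertices_subset P hv, he⟩
    have hcont : Continuous fun ε : ℝ => (c + ε • u) ⬝ᵥ g - (c + ε • u) ⬝ᵥ v := by
      simp only [add_dotProduct, smul_dotProduct]
      fun_prop
    have := hcont.tendsto 0
    simp only [zero_smul, add_zero] at this
    filter_upwards [Filter.Tendsto.eventually_const_lt (sub_pos.2 hlt)
        (Filter.Tendsto.mono_left this nhdsWithin_le_nhds)]
      with ε hε using sub_pos.1 hε
  have hfin : (vertices P \ maxFace P c).Finite := hP.finite_vertices.subset Set.sdiff_subset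
  obtain ⟨ε, hε, hpos⟩ := (((Set.Finite.eventually_all hfin).2 hev).and
    self_mem_nhdsWithin).exists
  have hpos' : (0 : ℝ) < ε := hpos
  have hle : ∀ v ∈ vertices P, (c + ε • u) ⬝ᵥ v ≤ (c + ε • u) ⬝ᵥ g ∧
      ((c + ε • u) ⬝ᵥ v = (c + ε • u) ⬝ᵥ g → v ∈ maxFace (maxFace P c) u) := by
    intro v hv
    by_cases hvc : v ∈ maxFace P c
    · have h1 := ((mem_maxFace_iff hg.1).1 hvc).2
      have h2 := hg.2 v hvc
      simp only [add_dotProduct, smul_dotProduct, smul_eq_mul, h1]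
      refine ⟨by gcongr, fun h3 => (mem_maxFace_iff hg).2 ⟨hvc, ?_⟩⟩
      exact mul_left_cancel₀ hpos'.ne' (add_left_cancel h3)
    · have := hε v ⟨hv, hvc⟩
      exact ⟨this.le, fun h => absurd h this.ne⟩
  have hgP : g ∈ maxFace P (c + ε • u) := by
    refine ⟨hg.1.1, fun y hy => ?_⟩
    rw [← hP.convexHull_vertices] at hy
    exact dotProduct_le_of_mem_convexHull (fun v hv => (hle v hv).1) hy
  refine ⟨ε, hpos, Set.Subset.antisymm ?_ ?_⟩
  · refine maxFace_subset_of_vertices hP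
      (hF'.2.convex (hF.2.convex hP.convex)) fun v hv hvm => (hle v hv).2 ?_
    exact ((mem_maxFace_iff hgP).1 hvm).2
  · intro x hx
    refine (mem_maxFace_iff hgP).2 ⟨hx.1.1, ?_⟩
    simp only [add_dotProduct, smul_dotProduct, ((mem_maxFace_iff hg.1).1 hx.1).2,
      ((mem_maxFace_iff hg).1 hx).2]

/-- Not formal, since exposed faces of general convex sets are not transitive; for polytopes the
perturbed functional `c + ε • u` exposes `G` in `P`. -/
lemma IsFace.trans {P F G : Set (Fin d → ℝ)} (hP : IsPolytope P) (hF : IsFace P F)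
    (hG : IsFace F G) : IsFace P G := by
  obtain ⟨hne, c, rfl⟩ := isFace_iff.1 hF
  obtain ⟨hne', u, rfl⟩ := isFace_iff.1 hG
  obtain ⟨ε, -, h⟩ := exists_maxFace_maxFace hP (hne.mono (maxFace_subset P c)) c u
  exact isFace_iff.2 ⟨hne', _, h.symm⟩

/-- Every vertex of a polytope is a face. -/
lemma IsPolytope.isFace_singleton {P : Set (Fin d → ℝ)} (hP : IsPolytope P) {v : Fin d → ℝ}
    (hv : v ∈ vertices P) : IsFace P {v} := by
  have hfin : (vertices P \ {v}).Finite := hP.finite_vertices.subset Set.sdiff_subset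
  have hnot : v ∉ convexHull ℝ (vertices P \ {v}) := by
    intro hmem
    refine (hP.convex.mem_extremePoints_iff_mem_sdiff_convexHull_sdiff.1 hv).2 ?_
    exact convexHull_mono (Set.sdiff_subset_sdiff_left (vertices_subset P)) hmem
  obtain ⟨l, a, hl, hla⟩ := geometric_hahn_banach_point_closed (convex_convexHull ℝ _)
    (hfin.isClosed_convexHull ℝ) hnot
  -- The separating functional is smaller at `v` than at the other vertices, hence the sign.
  obtain ⟨c, hc⟩ := exists_dotProduct_eq (-l.toLinearMap)
  have hlt : ∀ w ∈ vertices P, w ≠ v → c ⬝ᵥ w < c ⬝ᵥ v := by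
    intro w hw hwv
    rw [← hc, ← hc]
    have := hla w (subset_convexHull ℝ _ ⟨hw, hwv⟩)
    simpa using hl.trans this
  have hvm : v ∈ maxFace P c := by
    refine ⟨vertices_subset P hv, fun y hy => ?_⟩
    rw [← hP.convexHull_vertices] at hy
    refine dotProduct_le_of_mem_convexHull (fun w hw => ?_) hy
    by_cases h : w = v
    · rw [h]
    · exact (hlt w hw h).le
  refine isFace_iff.2 ⟨⟨v, rfl⟩, c, Set.Subset.antisymm (by simpa using hvm) ?_⟩
  refine maxFace_subset_of_vertices hP (convex_singleton v) fun w hw hwm => ?_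
  by_contra h
  exact (hlt w hw h).ne ((mem_maxFace_iff hvm).1 hwm).2

lemma IsFace.mem_vertices {P : Set (Fin d → ℝ)} {v : Fin d → ℝ} (h : IsFace P {v}) :
    v ∈ vertices P := isExtreme_singleton.1 h.2.isExtreme

/-! ### Normal cones -/

/-- The normal cone of a face `G` spans the space of functionals that are constant on `G`. -/
lemma span_normalCone {P G : Set (Fin d → ℝ)} (hP : IsPolytope P) (hG : IsFace P G) :
    (Submodule.span ℝ (normalCone P G)).map (dotProductEquiv ℝ (Fin d)).toLinearMap =
      (vectorSpan ℝ G).dualAnnihilator := by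
  obtain ⟨hne, c, rfl⟩ := isFace_iff.1 hG
  have hc : c ∈ normalCone P (maxFace P c) := fun x hx y hy => hx.2 y hy
  apply le_antisymm
  · rw [Submodule.map_span, Submodule.span_le]
    rintro _ ⟨u, hu, rfl⟩
    rw [SetLike.mem_coe, Submodule.mem_dualAnnihilator, vectorSpan_def]
    intro w hw
    induction hw using Submodule.span_induction with
    | mem w hw =>
      obtain ⟨x, hx, y, hy, rfl⟩ := hw
      have := le_antisymm (hu x hx y hy.1) (hu y hy x hx.1)
      change u ⬝ᵥ (x - y) = 0
      rw [dotProduct_sub, this, sub_self]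
    | zero => simp
    | add x y _ _ hx hy => rw [map_add, hx, hy, add_zero]
    | smul a x _ hx => rw [map_smul, hx, smul_zero]
  · intro l hl
    obtain ⟨u, rfl⟩ := (dotProductEquiv ℝ (Fin d)).surjective l
    refine ⟨u, ?_, rfl⟩
    rw [Submodule.mem_dualAnnihilator] at hl
    have hconst : ∀ x ∈ maxFace P c, ∀ y ∈ maxFace P c, u ⬝ᵥ y = u ⬝ᵥ x := by
      intro x hx y hy
      have : u ⬝ᵥ (y - x) = 0 := hl _ (vsub_mem_vectorSpan ℝ hy hx)
      rwa [dotProduct_sub, sub_eq_zero] at this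
    -- As `u` is constant on the face, `c + ε • u` still lies in the normal cone, and `u` is a
    -- multiple of a difference of two of its elements.
    obtain ⟨ε, hε, h⟩ := exists_maxFace_maxFace hP (hne.mono (maxFace_subset P c)) c u
    have hu : c + ε • u ∈ normalCone P (maxFace P c) := by
      intro x hx y hy
      have hx' : x ∈ maxFace P (c + ε • u) := by
        rw [h]
        exact ⟨hx, fun z hz => (hconst x hx z hz).le⟩
      exact hx'.2 y hy
    have := Submodule.smul_mem _ ε⁻¹ (Submodule.sub_mem _ (Submodule.subset_span hu)
      (Submodule.subset_span hc))
    rwa [add_sub_cancel_left, inv_smul_smul₀ hε.ne'] at this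

lemma finrank_span_normalCone_add_affDim {P G : Set (Fin d → ℝ)} (hP : IsPolytope P)
    (hG : IsFace P G) :
    Module.finrank ℝ (Submodule.span ℝ (normalCone P G)) + affDim G = d := by
  have h1 := Subspace.finrank_add_finrank_dualAnnihilator_eq (vectorSpan ℝ G)
  rw [← span_normalCone hP hG, LinearEquiv.finrank_map_eq, Module.finrank_fin_fun] at h1
  rw [affDim, add_comm]
  exact h1

/-- The functional exposing `G` lies in the normal cone of `G`; if it also lies in that of `G'`, it
is maximal on `G'`. -/
lemma normalCone_subset_iff {P G G' : Set (Fin d → ℝ)} (hG : IsFace P G)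
    (hG' : IsFace P G') : normalCone P G ⊆ normalCone P G' ↔ G' ⊆ G := by
  constructor
  · intro h x hx
    obtain ⟨hne, c, rfl⟩ := isFace_iff.1 hG
    exact ⟨hG'.subset hx, h (fun x hx y hy => hx.2 y hy) x hx⟩
  · exact fun h c hc x hx => hc x (h hx)

lemma injOn_normalCone (P : Set (Fin d → ℝ)) : Set.InjOn (normalCone P) {G | IsFace P G} :=
  fun _ hG _ hG' h => Set.Subset.antisymm ((normalCone_subset_iff hG' hG).1 h.ge)
    ((normalCone_subset_iff hG hG').1 h.le)

lemma affDim_eq_zero_iff {G : Set (Fin d → ℝ)} : affDim G = 0 ↔ G.Subsingleton := by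
  rw [affDim, Submodule.finrank_eq_zero]
  refine ⟨fun h x hx y hy => ?_, vectorSpan_of_subsingleton ℝ⟩
  have : x - y ∈ vectorSpan ℝ G := vsub_mem_vectorSpan ℝ hx hy
  rwa [h, Submodule.mem_bot, sub_eq_zero] at this

lemma conesOfDim_normalFan {P : Set (Fin d → ℝ)} (hP : IsPolytope P) {k m : ℕ} (h : k + m = d) :
    conesOfDim (normalFan P) k = normalCone P '' {G | IsFace P G ∧ affDim G = m} := by
  ext C
  constructor
  · rintro ⟨⟨G, hG, rfl⟩, hC⟩
    have := finrank_span_normalCone_add_affDim hP hG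
    exact ⟨G, ⟨hG, by omega⟩, rfl⟩
  · rintro ⟨G, ⟨hG, hm⟩, rfl⟩
    have := finrank_span_normalCone_add_affDim hP hG
    exact ⟨⟨G, hG, rfl⟩, by omega⟩

lemma conesOfDim_top_normalFan {P : Set (Fin d → ℝ)} (hP : IsPolytope P) :
    conesOfDim (normalFan P) d = (fun v => normalCone P {v}) '' vertices P := by
  rw [conesOfDim_normalFan hP (add_zero d)]
  ext C
  constructor
  · rintro ⟨G, ⟨hG, h0⟩, rfl⟩
    obtain ⟨v, rfl⟩ := (Set.exists_eq_singleton_iff_nonempty_subsingleton).2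
      ⟨hG.1, affDim_eq_zero_iff.1 h0⟩
    exact ⟨v, hG.mem_vertices, rfl⟩
  · rintro ⟨v, hv, rfl⟩
    exact ⟨{v}, ⟨hP.isFace_singleton hv, affDim_eq_zero_iff.2 Set.subsingleton_singleton⟩, rfl⟩

lemma injOn_normalCone_singleton {P : Set (Fin d → ℝ)} (hP : IsPolytope P) :
    Set.InjOn (fun v => normalCone P {v}) (vertices P) := fun _ hv _ hw h =>
  Set.singleton_injective
    (injOn_normalCone P (hP.isFace_singleton hv) (hP.isFace_singleton hw) h)

lemma ncard_conesOfDim_top {P : Set (Fin d → ℝ)} (hP : IsPolytope P) :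
    (conesOfDim (normalFan P) d).ncard = (vertices P).ncard := by
  rw [conesOfDim_top_normalFan hP, (injOn_normalCone_singleton hP).ncard_image]

lemma rayDegree_normalCone {P G : Set (Fin d → ℝ)} (hP : IsPolytope P) (hG : IsFace P G) :
    rayDegree (normalFan P) (normalCone P G) = (vertices G).ncard := by
  have : {C | C ∈ conesOfDim (normalFan P) d ∧ normalCone P G ⊆ C} =
      (fun v => normalCone P {v}) '' vertices G := by
    rw [conesOfDim_top_normalFan hP, hG.vertices_eq]
    ext C
    constructor
    · rintro ⟨⟨v, hv, rfl⟩, h⟩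
      exact ⟨v, ⟨by simpa using (normalCone_subset_iff hG (hP.isFace_singleton hv)).1 h, hv⟩, rfl⟩
    · rintro ⟨v, ⟨hvG, hv⟩, rfl⟩
      exact ⟨⟨v, hv, rfl⟩,
        (normalCone_subset_iff hG (hP.isFace_singleton hv)).2 (by simpa using hvG)⟩
  rw [rayDegree, this, Set.InjOn.ncard_image]
  exact (injOn_normalCone_singleton hP).mono (hG.vertices_eq ▸ Set.inter_subset_right)

lemma IsPolytope.finite_normalFan {P : Set (Fin d → ℝ)} (hP : IsPolytope P) :
    (normalFan P).Finite := by
  refine (hP.finite_faces.image (normalCone P)).subset ?_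
  rintro _ ⟨G, hG, rfl⟩
  exact ⟨G, hG, rfl⟩

/-! ### Neighbours of a vertex -/

/-- If `v` is the only maximum of `⟨l, ·⟩` on `F` but not a maximum of `⟨c, ·⟩`, then for some
`t > 0` the functional `c + t l` is maximal at `v` and at some other vertex. -/
lemma exists_mem_maxFace_add_smul {F : Set (Fin d → ℝ)} (hF : IsPolytope F) {v l c : Fin d → ℝ}
    (hv : v ∈ F) (hl : ∀ x ∈ F, x ≠ v → l ⬝ᵥ x < l ⬝ᵥ v)
    (hc : ∃ x ∈ F, c ⬝ᵥ v < c ⬝ᵥ x) :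
    ∃ t : ℝ, 0 < t ∧ v ∈ maxFace F (c + t • l) ∧ ∃ x ∈ maxFace F (c + t • l), x ≠ v := by
  have hW : (vertices F \ {v}).Finite := hF.finite_vertices.subset Set.sdiff_subset
  obtain ⟨x₁, hx₁, hcx₁⟩ : ∃ x ∈ vertices F, c ⬝ᵥ v < c ⬝ᵥ x := by
    by_contra! hcon
    obtain ⟨x, hx, hcx⟩ := hc
    rw [← hF.convexHull_vertices] at hx
    exact absurd (dotProduct_le_of_mem_convexHull hcon hx) (not_le.2 hcx)
  have hx₁v : x₁ ≠ v := by rintro rfl; exact lt_irrefl _ hcx₁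
  -- The ratio is the value of `t` at which `x` and `v` tie under `c + t • l`; the largest one lets
  -- no vertex beat `v` and makes `x₀` tie.
  obtain ⟨x₀, hx₀, hmax⟩ := Set.exists_max_image (vertices F \ {v})
    (fun x => (c ⬝ᵥ x - c ⬝ᵥ v) / (l ⬝ᵥ v - l ⬝ᵥ x)) hW ⟨x₁, hx₁, hx₁v⟩
  have hpos : ∀ x ∈ vertices F \ {v}, 0 < l ⬝ᵥ v - l ⬝ᵥ x := fun x hx =>
    sub_pos.2 (hl x (vertices_subset F hx.1) hx.2)
  set t := (c ⬝ᵥ x₀ - c ⬝ᵥ v) / (l ⬝ᵥ v - l ⬝ᵥ x₀) with ht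
  have ht0 : 0 < t :=
    (div_pos (sub_pos.2 hcx₁) (hpos x₁ ⟨hx₁, hx₁v⟩)).trans_le (hmax x₁ ⟨hx₁, hx₁v⟩)
  have hvm : v ∈ maxFace F (c + t • l) := by
    refine ⟨hv, fun y hy => ?_⟩
    rw [← hF.convexHull_vertices] at hy
    refine dotProduct_le_of_mem_convexHull (fun x hx => ?_) hy
    rcases eq_or_ne x v with rfl | hxv
    · exact le_rfl
    have h1 := (div_le_iff₀ (hpos x ⟨hx, hxv⟩)).1 (hmax x ⟨hx, hxv⟩)
    simp only [add_dotProduct, smul_dotProduct, smul_eq_mul]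
    linarith
  refine ⟨t, ht0, hvm, x₀, (mem_maxFace_iff hvm).2 ⟨vertices_subset F hx₀.1, ?_⟩, hx₀.2⟩
  have h1 := (div_eq_iff (hpos x₀ hx₀).ne').1 ht.symm
  simp only [add_dotProduct, smul_dotProduct, smul_eq_mul]
  linarith

lemma IsPolytope.exists_vertex_ne {F : Set (Fin d → ℝ)} (hF : IsPolytope F) {v : Fin d → ℝ}
    (hne : ∃ x ∈ F, x ≠ v) : ∃ x ∈ vertices F, x ≠ v := by
  by_contra! hcon
  obtain ⟨x, hx, hxv⟩ := hne
  rw [← hF.convexHull_vertices] at hx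
  exact hxv (by simpa using convexHull_min (t := {v}) hcon (convex_singleton v) hx)

/-- Every face of dimension at least one contains a neighbour of each of its vertices. -/
lemma IsFace.exists_neighbor {P : Set (Fin d → ℝ)} (hP : IsPolytope P) {v : Fin d → ℝ}
    (hv : v ∈ vertices P) {F : Set (Fin d → ℝ)} (hF : IsFace P F) (hvF : v ∈ F)
    (hne : ∃ x ∈ F, x ≠ v) : ∃ w ∈ neighbors P v, w ∈ F := by
  obtain ⟨l, hl⟩ := (isFace_iff.1 (hP.isFace_singleton hv)).2
  have hvl : v ∈ maxFace P l := hl ▸ rfl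
  have hlt : ∀ x ∈ P, x ≠ v → l ⬝ᵥ x < l ⬝ᵥ v := by
    intro x hx hxv
    refine lt_of_le_of_ne (hvl.2 x hx) fun h => hxv ?_
    have := (mem_maxFace_iff hvl).2 ⟨hx, h⟩
    rwa [← hl] at this
  induction hn : (vertices F).ncard using Nat.strong_induction_on generalizing F with
  | _ n ih =>
  have hFp := hF.isPolytope hP
  obtain ⟨x, hx, hxv⟩ := hFp.exists_vertex_ne hne
  have hxF := vertices_subset F hx
  -- With such a `c`, tilting by `l` yields a face through `v` that is not just `{v}` and loses the
  -- vertex `x`, so induction applies. Otherwise, using `c` and `-c`, every functional agreeing at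
  -- `x` and `v` is constant on `F`, which is therefore an edge.
  by_cases hcase : ∃ c : Fin d → ℝ, c ⬝ᵥ x = c ⬝ᵥ v ∧ ∃ y ∈ F, c ⬝ᵥ v < c ⬝ᵥ y
  · obtain ⟨c, hcx, hcy⟩ := hcase
    obtain ⟨t, ht, hvm, z, hz, hzv⟩ := exists_mem_maxFace_add_smul hFp hvF
      (fun x hx => hlt x (hF.subset hx)) hcy
    have hface := isFace_maxFace hFp hF.1 (c + t • l)
    have hcard : (vertices (maxFace F (c + t • l))).ncard < n := by
      rw [← hn]
      refine Set.ncard_lt_ncard ?_ hFp.finite_vertices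
      rw [hface.vertices_eq]
      refine ⟨Set.inter_subset_right, fun h => ?_⟩
      have := ((mem_maxFace_iff hvm).1 (h hx).1).2
      simp only [add_dotProduct, smul_dotProduct, smul_eq_mul, hcx] at this
      have h2 := hlt x (hF.subset hxF) hxv
      have h3 := mul_lt_mul_of_pos_left h2 ht
      linarith
    obtain ⟨w, hw, hwF⟩ := ih _ hcard (hF.trans hP hface) hvm ⟨z, hz, hzv⟩ rfl
    exact ⟨w, hw, hwF.1⟩
  · have hspan : vectorSpan ℝ F = Submodule.span ℝ {x - v} := by
      apply le_antisymm
      · rw [← Subspace.dualAnnihilator_le_dualAnnihilator_iff]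
        intro f hf
        obtain ⟨c, hc⟩ := exists_dotProduct_eq f
        rw [Submodule.mem_dualAnnihilator] at hf
        have hcx : c ⬝ᵥ x = c ⬝ᵥ v := by
          have := hf _ (Submodule.mem_span_singleton_self _)
          rwa [hc, dotProduct_sub, sub_eq_zero] at this
        have hle : ∀ y ∈ F, c ⬝ᵥ y = c ⬝ᵥ v := by
          intro y hy
          apply le_antisymm
          · by_contra! h
            exact hcase ⟨c, hcx, y, hy, h⟩
          · by_contra! h
            exact hcase ⟨-c, by simp [hcx], y, hy, by simpa using h⟩
        rw [Submodule.mem_dualAnnihilator, vectorSpan_def]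
        intro w hw
        induction hw using Submodule.span_induction with
        | mem w hw =>
          obtain ⟨a, ha, b, hb, rfl⟩ := hw
          rw [hc]
          change c ⬝ᵥ (a - b) = 0
          rw [dotProduct_sub, hle a ha, hle b hb, sub_self]
        | zero => simp
        | add x y _ _ hx hy => rw [map_add, hx, hy, add_zero]
        | smul a x _ hx => rw [map_smul, hx, smul_zero]
      · rw [Submodule.span_singleton_le_iff_mem]
        exact vsub_mem_vectorSpan ℝ hxF hvF
    refine ⟨x, ⟨(hF.vertices_eq ▸ hx).2, hxv, F, hF, ?_, hvF, hxF⟩, hxF⟩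
    rw [affDim, hspan, finrank_span_singleton (sub_ne_zero.2 hxv)]

/-- A vertex that is maximal among its neighbours is maximal on the whole polytope. -/
lemma IsPolytope.dotProduct_le_of_neighbors {P : Set (Fin d → ℝ)} (hP : IsPolytope P)
    {v c : Fin d → ℝ} (hv : v ∈ vertices P) (h : ∀ w ∈ neighbors P v, c ⬝ᵥ w ≤ c ⬝ᵥ v)
    {x : Fin d → ℝ} (hx : x ∈ P) : c ⬝ᵥ x ≤ c ⬝ᵥ v := by
  by_contra! hlt
  obtain ⟨l, hl⟩ := (isFace_iff.1 (hP.isFace_singleton hv)).2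
  have hvl : v ∈ maxFace P l := hl ▸ rfl
  have hl' : ∀ x ∈ P, x ≠ v → l ⬝ᵥ x < l ⬝ᵥ v := by
    intro x hx hxv
    refine lt_of_le_of_ne (hvl.2 x hx) fun h => hxv ?_
    have := (mem_maxFace_iff hvl).2 ⟨hx, h⟩
    rwa [← hl] at this
  obtain ⟨t, ht, hvm, hne⟩ := exists_mem_maxFace_add_smul hP (vertices_subset P hv) hl'
    ⟨x, hx, hlt⟩
  -- A neighbour on the tilted face ties with `v`, yet it is no better for `c` and strictly worse
  -- for `l`.
  obtain ⟨w, hw, hwF⟩ := IsFace.exists_neighbor hP hv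
    (isFace_maxFace hP ⟨x, hx⟩ (c + t • l)) hvm hne
  have h1 := ((mem_maxFace_iff hvm).1 hwF).2
  have h2 := hl' w hwF.1 hw.2.1
  have h3 := mul_lt_mul_of_pos_left h2 ht
  have h4 := h w hw
  simp only [add_dotProduct, smul_dotProduct, smul_eq_mul] at h1
  linarith

/-! ### The lattice -/

lemma toReal_injective : Function.Injective (toReal (d := d)) := fun z w h =>
  funext fun i => by simpa [toReal] using congrFun h i

lemma toReal_sub (z w : Fin d → ℤ) : toReal (z - w) = toReal z - toReal w := by
  ext i; simp [toReal]

lemma toReal_smul (a : ℤ) (z : Fin d → ℤ) : toReal (a • z) = (a : ℝ) • toReal z := by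
  ext i; simp [toReal]

lemma toReal_vecMul {m n : ℕ} (z : Fin m → ℤ) (A : Matrix (Fin m) (Fin n) ℤ) :
    toReal (Matrix.vecMul z A) = Matrix.vecMul (toReal z) (A.map (Int.cast : ℤ → ℝ)) := by
  ext i; simp [toReal, Matrix.vecMul, dotProduct]

lemma gcd_nonneg (z : Fin d → ℤ) : 0 ≤ Finset.univ.gcd z := by
  exact (Int.nonneg_iff_normalize_eq_self _).1 Finset.normalize_gcd

lemma gcd_smul_primitive (z : Fin d → ℤ) : Finset.univ.gcd z • primitive z = z := by
  ext i
  simp only [primitive, Pi.smul_apply, smul_eq_mul]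
  exact Int.mul_ediv_cancel' (Finset.gcd_dvd (Finset.mem_univ i))

lemma gcd_pos {z : Fin d → ℤ} (hz : z ≠ 0) : 0 < Finset.univ.gcd z := by
  refine lt_of_le_of_ne (gcd_nonneg z) fun h => hz ?_
  ext i
  exact Finset.gcd_eq_zero_iff.1 h.symm i (Finset.mem_univ i)

/-- An integer matrix can only replace the gcd by a multiple, and applying `C` after `B` returns to
`z`. -/
lemma gcd_vecMul_eq {m n : ℕ} {B : Matrix (Fin m) (Fin n) ℤ} {C : Matrix (Fin n) (Fin m) ℤ}
    (h : B * C = 1) (z : Fin m → ℤ) :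
    Finset.univ.gcd (Matrix.vecMul z B) = Finset.univ.gcd z := by
  have key : ∀ {m n : ℕ} (B : Matrix (Fin m) (Fin n) ℤ) (z : Fin m → ℤ),
      Finset.univ.gcd z ∣ Finset.univ.gcd (Matrix.vecMul z B) := by
    intro m n B z
    refine Finset.dvd_gcd fun j _ => ?_
    rw [Matrix.vecMul, dotProduct]
    refine Finset.dvd_sum fun i _ => ?_
    exact (Finset.gcd_dvd (Finset.mem_univ i)).mul_right _
  refine Int.dvd_antisymm (gcd_nonneg _) (gcd_nonneg _) ?_ (key B z)
  have := key C (Matrix.vecMul z B)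
  rwa [Matrix.vecMul_vecMul, h, Matrix.vecMul_one] at this

lemma primitive_vecMul {m n : ℕ} {B : Matrix (Fin m) (Fin n) ℤ} {C : Matrix (Fin n) (Fin m) ℤ}
    (h : B * C = 1) (z : Fin m → ℤ) :
    primitive (Matrix.vecMul z B) = Matrix.vecMul (primitive z) B := by
  by_cases hz : z = 0
  · subst hz
    simp only [Matrix.zero_vecMul]
    have : ∀ k, primitive (0 : Fin k → ℤ) = 0 := fun k => by ext i; simp [primitive]
    simp [this]
  have hg := gcd_pos hz
  have h1 := gcd_smul_primitive (Matrix.vecMul z B)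
  rw [gcd_vecMul_eq h] at h1
  conv_rhs at h1 => rw [← gcd_smul_primitive z, Matrix.smul_vecMul]
  exact smul_right_injective _ hg.ne' h1

/-! ### Coordinates in the basis of primitive edge directions -/

/-- The real matrix with the entries of the integer matrix `A`. -/
abbrev realMat {m n : ℕ} (A : Matrix (Fin m) (Fin n) ℤ) : Matrix (Fin m) (Fin n) ℝ :=
  A.map (Int.cast : ℤ → ℝ)

lemma realMat_mul {m n k : ℕ} (A : Matrix (Fin m) (Fin n) ℤ) (B : Matrix (Fin n) (Fin k) ℤ) :
    realMat (A * B) = realMat A * realMat B :=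
  Matrix.map_mul (f := Int.castRingHom ℝ)

lemma realMat_one {m : ℕ} : realMat (1 : Matrix (Fin m) (Fin m) ℤ) = 1 := by
  simp [realMat]

/-- The matrix whose rows are the primitive directions from `v` to the points `w i`. -/
def edgeMatrix (v : Fin d → ℤ) (w : Fin d → Fin d → ℤ) : Matrix (Fin d) (Fin d) ℤ :=
  Matrix.of fun i => primitive (w i - v)

/-- The points `w i` are the neighbours of the vertex `v`, and `A` is the inverse of the matrix
of primitive edge directions at `v`. -/
structure IsEdgeFrame (P : Set (Fin d → ℝ)) (v : Fin d → ℤ) (w : Fin d → Fin d → ℤ)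
    (A : Matrix (Fin d) (Fin d) ℤ) : Prop where
  mem : toReal v ∈ vertices P
  range : Set.range (fun i => toReal (w i)) = neighbors P (toReal v)
  mul_inv : edgeMatrix v w * A = 1

lemma IsSmooth.exists_isEdgeFrame {P : Set (Fin d → ℝ)} (hP : IsSmooth P) {v : Fin d → ℤ}
    (hv : toReal v ∈ vertices P) : ∃ w A, IsEdgeFrame P v w A := by
  obtain ⟨w, hw, hdet⟩ := hP.smooth v hv
  refine ⟨w, (edgeMatrix v w)⁻¹, hv, hw, Matrix.mul_nonsing_inv _ ?_⟩
  exact Int.isUnit_iff.2 hdet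

namespace IsEdgeFrame

variable {P : Set (Fin d → ℝ)} {v : Fin d → ℤ} {w : Fin d → Fin d → ℤ}
  {A : Matrix (Fin d) (Fin d) ℤ}

lemma inv_mul (h : IsEdgeFrame P v w A) : A * edgeMatrix v w = 1 :=
  mul_eq_one_comm.1 h.mul_inv

lemma mem_neighbors (h : IsEdgeFrame P v w A) (i : Fin d) :
    toReal (w i) ∈ neighbors P (toReal v) := h.range ▸ ⟨i, rfl⟩

lemma gcd_pos (h : IsEdgeFrame P v w A) (i : Fin d) : 0 < Finset.univ.gcd (w i - v) := by
  refine LatticePolytope.gcd_pos fun h0 => (h.mem_neighbors i).2.1 ?_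
  rw [sub_eq_zero.1 h0]

/-- The edges at `v` in terms of their primitive directions. -/
lemma sub_eq (h : IsEdgeFrame P v w A) (i : Fin d) :
    ∃ g : ℝ, 0 < g ∧ toReal (w i) - toReal v = g • toReal (edgeMatrix v w i) := by
  refine ⟨(Finset.univ.gcd (w i - v) : ℤ), by exact_mod_cast h.gcd_pos i, ?_⟩
  rw [← toReal_sub, ← toReal_smul]
  exact congrArg _ (gcd_smul_primitive _).symm

lemma vecMul_edge (h : IsEdgeFrame P v w A) (i : Fin d) :
    Matrix.vecMul (toReal (edgeMatrix v w i)) (realMat A) = Pi.single i 1 := by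
  rw [← toReal_vecMul]
  have : Matrix.vecMul (edgeMatrix v w i) A = (1 : Matrix _ _ ℤ) i := by
    rw [← h.mul_inv]; rfl
  rw [this]
  ext j
  simp [toReal, Matrix.one_apply, Pi.single_apply, eq_comm]

/-- Expansion of a vector in the primitive edge directions. -/
lemma eq_sum (h : IsEdgeFrame P v w A) (x : Fin d → ℝ) :
    x = ∑ i, Matrix.vecMul x (realMat A) i • toReal (edgeMatrix v w i) := by
  have h1 : realMat A * realMat (edgeMatrix v w) = 1 := by
    rw [← realMat_mul, h.inv_mul, realMat_one]
  conv_lhs => rw [← Matrix.vecMul_one x, ← h1, ← Matrix.vecMul_vecMul]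
  ext j
  simp [Matrix.vecMul, dotProduct, toReal]

lemma linearIndependent (h : IsEdgeFrame P v w A) :
    LinearIndependent ℝ fun i => toReal (edgeMatrix v w i) := by
  have h1 : realMat (edgeMatrix v w) * realMat A = 1 := by
    rw [← realMat_mul, h.mul_inv, realMat_one]
  exact Matrix.linearIndependent_rows_iff_isUnit.2 (IsUnit.of_mul_eq_one _ h1)

/-- The coordinates of the points of `P` at the vertex `v` are nonnegative. -/
lemma coord_nonneg (h : IsEdgeFrame P v w A) (hP : IsPolytope P) {x : Fin d → ℝ} (hx : x ∈ P)
    (j : Fin d) : 0 ≤ Matrix.vecMul (x - toReal v) (realMat A) j := by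
  -- Minus the `j`-th coordinate is a functional, so it suffices to test it on the neighbours, whose
  -- coordinates are positive multiples of unit vectors.
  have key : ∀ y, (fun k => -realMat A k j) ⬝ᵥ y = -Matrix.vecMul y (realMat A) j := fun y => by
    simp [Matrix.vecMul, dotProduct, mul_comm]
  have := hP.dotProduct_le_of_neighbors h.mem (c := fun k => -realMat A k j) ?_ hx
  · rw [key, key, neg_le_neg_iff] at this
    rw [Matrix.sub_vecMul]
    exact sub_nonneg.2 this
  · rw [← h.range]
    rintro _ ⟨i, rfl⟩
    obtain ⟨g, hg, he⟩ := h.sub_eq i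
    rw [key, key, neg_le_neg_iff, ← sub_nonneg, ← Pi.sub_apply, ← Matrix.sub_vecMul, he,
      Matrix.smul_vecMul, h.vecMul_edge]
    by_cases hij : j = i <;> simp [hij, hg.le]

/-- The functional exposing `G` vanishes on `x - v`, a sum of nonnegative coordinates times
nonpositive slopes. Each term is zero, and the slope is nonzero along an edge leaving `G`. -/
lemma coord_of_mem_face (h : IsEdgeFrame P v w A) (hP : IsPolytope P) {G : Set (Fin d → ℝ)}
    (hG : IsFace P G) (hv : toReal v ∈ G) {x : Fin d → ℝ} (hx : x ∈ G) {i : Fin d}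
    (hi : toReal (w i) ∉ G) : Matrix.vecMul (x - toReal v) (realMat A) i = 0 := by
  obtain ⟨-, c, rfl⟩ := isFace_iff.1 hG
  have hc : ∀ j, c ⬝ᵥ toReal (edgeMatrix v w j) ≤ 0 ∧
      (c ⬝ᵥ toReal (edgeMatrix v w j) = 0 → toReal (w j) ∈ maxFace P c) := by
    intro j
    obtain ⟨g, hg, he⟩ := h.sub_eq j
    have hw := vertices_subset P (h.mem_neighbors j).1
    have h1 : c ⬝ᵥ toReal (w j) - c ⬝ᵥ toReal v = g * (c ⬝ᵥ toReal (edgeMatrix v w j)) := by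
      rw [← dotProduct_sub, he, dotProduct_smul, smul_eq_mul]
    refine ⟨?_, fun h0 => (mem_maxFace_iff hv).2 ⟨hw, ?_⟩⟩
    · have := hv.2 _ hw
      by_contra! hlt
      have := mul_pos hg hlt
      linarith
    · rw [h0, mul_zero] at h1
      linarith
  have h0 : c ⬝ᵥ (x - toReal v) = 0 := by
    rw [dotProduct_sub, ((mem_maxFace_iff hv).1 hx).2, sub_self]
  rw [h.eq_sum (x - toReal v), dotProduct_sum] at h0
  simp only [dotProduct_smul, smul_eq_mul] at h0
  have h2 := (Finset.sum_eq_zero_iff_of_nonpos fun j _ =>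
    mul_nonpos_of_nonneg_of_nonpos (h.coord_nonneg hP hx.1 j) (hc j).1).1 h0 i (Finset.mem_univ i)
  exact (mul_eq_zero.1 h2).resolve_right fun h3 => hi ((hc i).2 h3)

/-- The dimension of a face containing `v` is the number of neighbours of `v` in it. -/
lemma affDim_eq (h : IsEdgeFrame P v w A) (hP : IsPolytope P) {G : Set (Fin d → ℝ)}
    (hG : IsFace P G) (hv : toReal v ∈ G) :
    affDim G = {i | toReal (w i) ∈ G}.ncard := by
  set S := {i | toReal (w i) ∈ G} with hS
  have hspan : vectorSpan ℝ G =
      Submodule.span ℝ (Set.range fun i : S => toReal (edgeMatrix v w i)) := by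
    apply le_antisymm
    · have hx : ∀ x ∈ G, x - toReal v ∈
          Submodule.span ℝ (Set.range fun i : S => toReal (edgeMatrix v w i)) := by
        intro x hx
        rw [h.eq_sum (x - toReal v)]
        refine Submodule.sum_mem _ fun i _ => ?_
        by_cases hi : toReal (w i) ∈ G
        · exact Submodule.smul_mem _ _ (Submodule.subset_span ⟨⟨i, hi⟩, rfl⟩)
        · rw [h.coord_of_mem_face hP hG hv hx hi, zero_smul]
          exact Submodule.zero_mem _
      rw [vectorSpan_def, Submodule.span_le]
      rintro _ ⟨x, hxG, y, hyG, rfl⟩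
      have := Submodule.sub_mem _ (hx x hxG) (hx y hyG)
      rwa [sub_sub_sub_cancel_right] at this
    · rw [Submodule.span_le]
      rintro _ ⟨⟨i, hi⟩, rfl⟩
      obtain ⟨g, hg, he⟩ := h.sub_eq i
      have hmem : toReal (w i) - toReal v ∈ vectorSpan ℝ G := vsub_mem_vectorSpan ℝ hi hv
      have := Submodule.smul_mem _ g⁻¹ hmem
      rwa [he, inv_smul_smul₀ hg.ne'] at this
  classical
  have hli : LinearIndependent ℝ fun i : S => toReal (edgeMatrix v w i) :=
    h.linearIndependent.comp _ Subtype.val_injective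
  rw [affDim, hspan, finrank_span_eq_card hli, ← Nat.card_eq_fintype_card,
    Nat.card_coe_set_eq]

/-- A facet through `v` contains all neighbours of `v` but one. -/
lemma exists_missing {n : ℕ} {P : Set (Fin (n + 1) → ℝ)} {v : Fin (n + 1) → ℤ}
    {w : Fin (n + 1) → Fin (n + 1) → ℤ} {A : Matrix (Fin (n + 1)) (Fin (n + 1)) ℤ}
    (h : IsEdgeFrame P v w A) (hP : IsPolytope P) {G : Set (Fin (n + 1) → ℝ)}
    (hG : IsFace P G) (hv : toReal v ∈ G) (hdim : affDim G = n) :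
    ∃ a, ∀ i, toReal (w i) ∈ G ↔ i ≠ a := by
  rw [h.affDim_eq hP hG hv] at hdim
  have h1 := Set.ncard_add_ncard_compl {i | toReal (w i) ∈ G}
  rw [hdim, Nat.card_eq_fintype_card, Fintype.card_fin] at h1
  obtain ⟨a, ha⟩ := Set.ncard_eq_one.1 (show {i | toReal (w i) ∈ G}ᶜ.ncard = 1 by omega)
  refine ⟨a, fun i => ?_⟩
  have := Set.ext_iff.1 ha i
  simp only [Set.mem_compl_iff, Set.mem_ofPred_eq, Set.mem_singleton_iff] at this
  tauto

/-- A polytope with an edge frame at some vertex has a facet. -/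
lemma exists_facet {n : ℕ} {P : Set (Fin (n + 1) → ℝ)} {v : Fin (n + 1) → ℤ}
    {w : Fin (n + 1) → Fin (n + 1) → ℤ} {A : Matrix (Fin (n + 1)) (Fin (n + 1)) ℤ}
    (h : IsEdgeFrame P v w A) (hP : IsPolytope P) :
    ∃ G, IsFace P G ∧ affDim G = n := by
  -- The facet is the locus where coordinate `0` at `v` vanishes; it misses only the neighbour `w
  -- 0`.
  set c : Fin (n + 1) → ℝ := fun k => -realMat A k 0 with hc
  have key : ∀ y, c ⬝ᵥ y = -Matrix.vecMul y (realMat A) 0 := fun y => by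
    simp [hc, Matrix.vecMul, dotProduct, mul_comm]
  have hdiff : ∀ y, c ⬝ᵥ toReal v - c ⬝ᵥ y = Matrix.vecMul (y - toReal v) (realMat A) 0 := by
    intro y
    rw [key, key, Matrix.sub_vecMul, Pi.sub_apply]
    ring
  have hv : toReal v ∈ maxFace P c := by
    refine ⟨vertices_subset P h.mem, fun y hy => ?_⟩
    rw [← sub_nonneg, hdiff]
    exact h.coord_nonneg hP hy 0
  have hG : IsFace P (maxFace P c) := isFace_maxFace hP ⟨_, hv.1⟩ c
  refine ⟨_, hG, ?_⟩
  rw [h.affDim_eq hP hG hv]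
  have : {i | toReal (w i) ∈ maxFace P c} = {0}ᶜ := by
    ext i
    obtain ⟨g, hg, he⟩ := h.sub_eq i
    have h1 := hdiff (toReal (w i))
    rw [he, Matrix.smul_vecMul, h.vecMul_edge] at h1
    simp only [Set.mem_ofPred_eq, Set.mem_compl_iff, Set.mem_singleton_iff]
    rw [mem_maxFace_iff hv, and_iff_right (vertices_subset P (h.mem_neighbors i).1)]
    by_cases hi : i = 0
    · subst hi
      simp at h1
      simp only [not_true_eq_false, iff_false]
      intro h2
      rw [h2] at h1
      linarith
    · simp only [hi, not_false_eq_true, iff_true]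
      simp [Ne.symm hi] at h1
      linarith
  have h2 := Set.ncard_add_ncard_compl ({0} : Set (Fin (n + 1)))
  rw [Set.ncard_singleton, Nat.card_eq_fintype_card, Fintype.card_fin] at h2
  rw [this]
  omega

end IsEdgeFrame

/-! ### Lattice charts of faces -/

variable {m n : ℕ}

lemma IsPolytope.image {P : Set (Fin m → ℝ)} (hP : IsPolytope P)
    (f : (Fin m → ℝ) →ᵃ[ℝ] (Fin n → ℝ)) : IsPolytope (f '' P) := by
  obtain ⟨V, hV, rfl⟩ := hP
  exact ⟨f '' V, hV.image f, AffineMap.image_convexHull f V⟩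

/-- The affine map `y ↦ v + y B`. -/
noncomputable def chart (v : Fin n → ℤ) (B : Matrix (Fin m) (Fin n) ℤ) :
    (Fin m → ℝ) →ᵃ[ℝ] (Fin n → ℝ) where
  toFun y := toReal v + Matrix.vecMul y (realMat B)
  linear := (realMat B).vecMulLinear
  map_vadd' p q := by
    simp only [vadd_eq_add, Matrix.add_vecMul, Matrix.vecMulLinear_apply]
    abel

lemma chart_apply (v : Fin n → ℤ) (B : Matrix (Fin m) (Fin n) ℤ) (y : Fin m → ℝ) :
    chart v B y = toReal v + Matrix.vecMul y (realMat B) := rfl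

lemma chart_toReal (v : Fin n → ℤ) (B : Matrix (Fin m) (Fin n) ℤ) (z : Fin m → ℤ) :
    chart v B (toReal z) = toReal (v + Matrix.vecMul z B) := by
  rw [chart_apply, ← toReal_vecMul]
  ext i
  simp [toReal]

lemma dotProduct_chart (v : Fin n → ℤ) (B : Matrix (Fin m) (Fin n) ℤ) (c : Fin n → ℝ)
    (y : Fin m → ℝ) :
    c ⬝ᵥ chart v B y = c ⬝ᵥ toReal v + Matrix.mulVec (realMat B) c ⬝ᵥ y := by
  rw [chart_apply, dotProduct_add, dotProduct_comm c (Matrix.vecMul _ _),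
    ← Matrix.dotProduct_mulVec, dotProduct_comm y]

/-- The map `y ↦ v + y B`, whose linear part has the integral left inverse `C`, parametrizes an
affine subspace that contains `G`. -/
structure IsChart (G : Set (Fin n → ℝ)) (v : Fin n → ℤ) (B : Matrix (Fin m) (Fin n) ℤ)
    (C : Matrix (Fin n) (Fin m) ℤ) : Prop where
  mul_eq_one : B * C = 1
  chart_retract : ∀ x ∈ G, chart v B (Matrix.vecMul (x - toReal v) (realMat C)) = x

namespace IsChart

variable {G : Set (Fin n → ℝ)} {v : Fin n → ℤ} {B : Matrix (Fin m) (Fin n) ℤ}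
  {C : Matrix (Fin n) (Fin m) ℤ}

lemma realMat_mul_eq_one (h : IsChart G v B C) : realMat B * realMat C = 1 := by
  rw [← realMat_mul, h.mul_eq_one, realMat_one]

lemma retract_chart (h : IsChart G v B C) (y : Fin m → ℝ) :
    Matrix.vecMul (chart v B y - toReal v) (realMat C) = y := by
  rw [chart_apply, add_sub_cancel_left, Matrix.vecMul_vecMul, h.realMat_mul_eq_one,
    Matrix.vecMul_one]

lemma injective (h : IsChart G v B C) : Function.Injective (chart v B) :=
  Function.LeftInverse.injective
    (g := fun x => Matrix.vecMul (x - toReal v) (realMat C)) h.retract_chart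

lemma image_preimage (h : IsChart G v B C) {E : Set (Fin n → ℝ)} (hE : E ⊆ G) :
    chart v B '' (chart v B ⁻¹' E) = E :=
  Set.image_preimage_eq_of_subset fun x hx => ⟨_, h.chart_retract x (hE hx)⟩

lemma chart_mem_lattice (h : IsChart G v B C) {y : Fin m → ℝ} :
    chart v B y ∈ lattice n ↔ y ∈ lattice m := by
  constructor
  · rintro ⟨z, hz⟩
    refine ⟨Matrix.vecMul (z - v) C, ?_⟩
    rw [toReal_vecMul, toReal_sub, hz, h.retract_chart]
  · rintro ⟨z, rfl⟩
    exact ⟨_, (chart_toReal v B z).symm⟩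

/-- The retraction `x ↦ (x - v) C` is itself an affine map of chart form, which turns the preimage
into an image. -/
lemma isPolytope (h : IsChart G v B C) (hG : IsPolytope G) :
    IsPolytope (chart v B ⁻¹' G) := by
  have : chart v B ⁻¹' G = chart (-Matrix.vecMul v C) C '' G := by
    have hx : ∀ x, chart (-Matrix.vecMul v C) C x =
        Matrix.vecMul (x - toReal v) (realMat C) := by
      intro x
      rw [chart_apply, Matrix.sub_vecMul, ← toReal_vecMul v C]
      ext i
      simp [toReal]
      ring
    ext y
    constructor
    · exact fun hy => ⟨_, hy, by rw [hx, h.retract_chart]⟩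
    · rintro ⟨x, hxG, rfl⟩
      rw [Set.mem_preimage, hx, h.chart_retract x hxG]
      exact hxG
  rw [this]
  exact hG.image _

lemma vertices_preimage (h : IsChart G v B C) :
    vertices (chart v B ⁻¹' G) = chart v B ⁻¹' vertices G := by
  ext y
  simp only [vertices, Set.mem_preimage, mem_extremePoints_iff_left]
  refine and_congr_right fun _ => ⟨fun hy x₁ hx₁ x₂ hx₂ hmem => ?_,
    fun hy x₁ hx₁ x₂ hx₂ hmem => ?_⟩
  · rw [← h.image_preimage subset_rfl] at hx₁ hx₂
    obtain ⟨y₁, hy₁, rfl⟩ := hx₁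
    obtain ⟨y₂, hy₂, rfl⟩ := hx₂
    rw [← image_openSegment, h.injective.mem_set_image] at hmem
    rw [hy y₁ hy₁ y₂ hy₂ hmem]
  · refine h.injective (hy _ hx₁ _ hx₂ ?_)
    rw [← image_openSegment]
    exact Set.mem_image_of_mem _ hmem

lemma preimage_maxFace (h : IsChart G v B C) (c : Fin n → ℝ) :
    chart v B ⁻¹' maxFace G c =
      maxFace (chart v B ⁻¹' G) (Matrix.mulVec (realMat B) c) := by
  ext y
  refine and_congr_right fun _ => ⟨fun hy z hz => ?_, fun hy z hz => ?_⟩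
  · have := hy _ hz
    rwa [dotProduct_chart, dotProduct_chart, add_le_add_iff_left] at this
  · rw [← h.image_preimage subset_rfl] at hz
    obtain ⟨z, hz, rfl⟩ := hz
    rw [dotProduct_chart, dotProduct_chart, add_le_add_iff_left]
    exact hy z hz

/-- Functionals pull back by `B`, and every functional `c` on the chart arises this way, as `c = B
(C c)`. -/
lemma isFace_preimage_iff (h : IsChart G v B C) {E : Set (Fin m → ℝ)} :
    IsFace (chart v B ⁻¹' G) E ↔ IsFace G (chart v B '' E) := by
  rw [isFace_iff, isFace_iff, Set.image_nonempty]
  refine and_congr_right fun _ => ⟨?_, ?_⟩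
  · rintro ⟨c, rfl⟩
    refine ⟨Matrix.mulVec (realMat C) c, ?_⟩
    rw [← h.image_preimage (maxFace_subset G _), h.preimage_maxFace, Matrix.mulVec_mulVec,
      h.realMat_mul_eq_one, Matrix.one_mulVec]
  · rintro ⟨c, hc⟩
    exact ⟨_, by rw [← h.preimage_maxFace, ← hc, Set.preimage_image_eq _ h.injective]⟩

lemma affDim_image (h : IsChart G v B C) (E : Set (Fin m → ℝ)) :
    affDim (chart v B '' E) = affDim E := by
  rw [affDim, affDim, ← AffineMap.map_vectorSpan]
  exact (Submodule.equivMapOfInjective _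
    ((chart v B).linear_injective_iff.2 h.injective) _).finrank_eq.symm

end IsChart

/-- An edge with two points in a face lies in the face. -/
lemma IsFace.subset_of_affDim_eq_one {P G E : Set (Fin n → ℝ)} (hG : IsFace P G) (hE : E ⊆ P)
    (hdim : affDim E = 1) {p q : Fin n → ℝ} (hp : p ∈ E) (hq : q ∈ E) (hpG : p ∈ G)
    (hqG : q ∈ G) (hpq : q ≠ p) : E ⊆ G := by
  have hspan : Submodule.span ℝ {q - p} = vectorSpan ℝ E := by
    refine Submodule.eq_of_le_of_finrank_eq ?_ ?_
    · rw [Submodule.span_singleton_le_iff_mem]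
      exact vsub_mem_vectorSpan ℝ hq hp
    · rw [finrank_span_singleton (sub_ne_zero.2 hpq)]
      exact hdim.symm
  obtain ⟨-, c, rfl⟩ := isFace_iff.1 hG
  intro x hx
  have hxp : x - p ∈ Submodule.span ℝ {q - p} := hspan ▸ vsub_mem_vectorSpan ℝ hx hp
  obtain ⟨t, ht⟩ := Submodule.mem_span_singleton.1 hxp
  refine (mem_maxFace_iff hpG).2 ⟨hE hx, ?_⟩
  rw [← sub_eq_zero, ← dotProduct_sub, ← ht, dotProduct_smul, dotProduct_sub,
    ((mem_maxFace_iff hpG).1 hqG).2, sub_self, smul_zero]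

lemma IsFace.mono {P G E : Set (Fin n → ℝ)} (hE : IsFace P E) (hG : G ⊆ P) (hEG : E ⊆ G) :
    IsFace G E := ⟨hE.1, hE.2.mono hG hEG⟩

/-- Adjacency is intrinsic to a face: an edge of `G` is an edge of `P` by transitivity, and an edge
of `P` joining two points of `G` lies in `G`. -/
lemma IsChart.neighbors_preimage {P G : Set (Fin n → ℝ)} {v : Fin n → ℤ}
    {B : Matrix (Fin m) (Fin n) ℤ} {C : Matrix (Fin n) (Fin m) ℤ} (h : IsChart G v B C)
    (hP : IsPolytope P) (hG : IsFace P G) {y : Fin m → ℝ} (hy : chart v B y ∈ G) :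
    neighbors (chart v B ⁻¹' G) y = chart v B ⁻¹' (neighbors P (chart v B y) ∩ G) := by
  ext w
  constructor
  · rintro ⟨hw, hwy, E, hE, hdim, hyE, hwE⟩
    rw [h.vertices_preimage, Set.mem_preimage, hG.vertices_eq] at hw
    exact ⟨⟨hw.2, h.injective.ne hwy, _, hG.trans hP (h.isFace_preimage_iff.1 hE),
      (h.affDim_image E).trans hdim, Set.mem_image_of_mem _ hyE, Set.mem_image_of_mem _ hwE⟩,
      hw.1⟩
  · rintro ⟨⟨hw, hwy, E, hE, hdim, hyE, hwE⟩, hwG⟩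
    have hEG := hG.subset_of_affDim_eq_one hE.subset hdim hyE hwE hy hwG hwy
    refine ⟨?_, fun he => hwy (he ▸ rfl), chart v B ⁻¹' E, ?_, ?_, hyE, hwE⟩
    · rw [h.vertices_preimage, Set.mem_preimage, hG.vertices_eq]
      exact ⟨hwG, hw⟩
    · rw [h.isFace_preimage_iff, h.image_preimage hEG]
      exact hE.mono hG.subset hEG
    · rw [← h.affDim_image, h.image_preimage hEG, hdim]

/-! ### Facets inherit smoothness -/

section Facet

variable {P G : Set (Fin (n + 1) → ℝ)} {v : Fin (n + 1) → ℤ}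
  {w : Fin (n + 1) → Fin (n + 1) → ℤ} {A : Matrix (Fin (n + 1)) (Fin (n + 1)) ℤ}
  {b : Fin (n + 1)}

/-- The coordinate along the edge to `w b` vanishes on `G`, so deleting row `b` of the edge matrix
and column `b` of its inverse loses nothing there. -/
lemma IsEdgeFrame.isChart (h : IsEdgeFrame P v w A) (hP : IsPolytope P) (hG : IsFace P G)
    (hv : toReal v ∈ G) (hb : toReal (w b) ∉ G) :
    IsChart G v ((edgeMatrix v w).submatrix b.succAbove id) (A.submatrix id b.succAbove) where
  mul_eq_one := by
    ext i j
    have := congrFun (congrFun h.mul_inv (b.succAbove i)) (b.succAbove j)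
    simp only [Matrix.one_apply, Fin.succAbove_right_inj] at this
    rw [Matrix.one_apply, ← this]
    rfl
  chart_retract x hx := by
    rw [chart_apply, ← eq_sub_iff_add_eq']
    conv_rhs => rw [h.eq_sum (x - toReal v), Fin.sum_univ_succAbove _ b,
      h.coord_of_mem_face hP hG hv hx hb, zero_smul, zero_add]
    ext j
    simp [Matrix.vecMul, dotProduct, toReal]

/-- A facet of a smooth polytope is a smooth polytope in a lattice chart. -/
lemma IsEdgeFrame.isSmooth_preimage (h : IsEdgeFrame P v w A) (hP : IsSmooth P)
    (hG : IsFace P G) (hdim : affDim G = n) (hv : toReal v ∈ G) (hb : toReal (w b) ∉ G) :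
    IsSmooth (chart v ((edgeMatrix v w).submatrix b.succAbove id) ⁻¹' G) := by
  have hc := h.isChart hP.isPolytope hG hv hb
  set B := (edgeMatrix v w).submatrix b.succAbove id with hB
  set C := A.submatrix id b.succAbove with hC
  have hlat : vertices (chart v B ⁻¹' G) ⊆ LatticePolytope.lattice n := by
    intro y hy
    rw [hc.vertices_preimage, Set.mem_preimage, hG.vertices_eq] at hy
    exact hc.chart_mem_lattice.1 (hP.lattice hy.2)
  have key : ∀ y : Fin n → ℤ, toReal y ∈ vertices (chart v B ⁻¹' G) →
      ∃ z : Fin n → Fin n → ℤ,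
        Set.range (fun i => toReal (z i)) = neighbors (chart v B ⁻¹' G) (toReal y) ∧
        Function.Injective z ∧ IsUnit (Matrix.of fun i => primitive (z i - y)).det := by
    intro y hy
    rw [hc.vertices_preimage, Set.mem_preimage, hG.vertices_eq] at hy
    obtain ⟨hyG, hyP⟩ := hy
    set v' := v + Matrix.vecMul y B with hv'
    have hchart : chart v B (toReal y) = toReal v' := chart_toReal v B y
    have hyG' := hyG
    rw [hchart] at hyP hyG'
    obtain ⟨w', A', h'⟩ := hP.exists_isEdgeFrame hyP
    obtain ⟨a, ha⟩ := h'.exists_missing hP.isPolytope hG hyG' hdim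
    set z : Fin n → Fin n → ℤ := fun i => Matrix.vecMul (w' (a.succAbove i) - v) C with hz
    have hzw : ∀ i, chart v B (toReal (z i)) = toReal (w' (a.succAbove i)) := by
      intro i
      rw [hz, toReal_vecMul, toReal_sub]
      exact hc.chart_retract _ ((ha _).2 (Fin.succAbove_ne a i))
    have hedge : ∀ i, Matrix.vecMul (primitive (z i - y)) B =
        edgeMatrix v' w' (a.succAbove i) := by
      intro i
      rw [← primitive_vecMul hc.mul_eq_one]
      refine congrArg primitive ?_
      have := hzw i
      rw [chart_toReal] at this
      rw [← toReal_injective this, hv', Matrix.sub_vecMul]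
      abel
    refine ⟨z, ?_, ?_, ?_⟩
    · rw [hc.neighbors_preimage hP.isPolytope hG hyG, hchart, ← h'.range]
      ext x
      constructor
      · rintro ⟨i, rfl⟩
        rw [Set.mem_preimage, hzw]
        exact ⟨⟨_, rfl⟩, (ha _).2 (Fin.succAbove_ne a i)⟩
      · rintro ⟨⟨k, hk⟩, hxG⟩
        simp only at hk
        rw [← hk, ha] at hxG
        obtain ⟨i, rfl⟩ := Fin.exists_succAbove_eq hxG
        exact ⟨i, hc.injective ((hzw i).trans hk)⟩
    · intro i j hij
      have h1 : edgeMatrix v' w' (a.succAbove i) = edgeMatrix v' w' (a.succAbove j) := by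
        rw [← hedge, ← hedge, hij]
      have := h'.linearIndependent.injective (congrArg toReal h1)
      exact Fin.succAbove_right_injective this
    -- `M` writes the edges at `v'` in the frame at `v` and is unimodular. Edges inside `G` have no
    -- `b`-component, so expanding along column `b` leaves only the entry in row `a` times the
    -- wanted minor.
    · set M := edgeMatrix v' w' * A with hM
      have hBA : ∀ i k, M (a.succAbove i) k =
          ∑ j, primitive (z i - y) j * (1 : Matrix _ _ ℤ) (b.succAbove j) k := by
        intro i k
        have h1 : M (a.succAbove i) = Matrix.vecMul (edgeMatrix v' w' (a.succAbove i)) A := rfl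
        rw [h1, ← hedge, Matrix.vecMul_vecMul, ← h.mul_inv]
        rfl
      have hMb : ∀ i, M (a.succAbove i) b = 0 := fun i => by
        rw [hBA]
        exact Finset.sum_eq_zero fun j _ => by
          rw [Matrix.one_apply_ne (Fin.succAbove_ne b j), mul_zero]
      have hsub : M.submatrix a.succAbove b.succAbove =
          Matrix.of fun i => primitive (z i - y) := by
        ext i j
        rw [Matrix.submatrix_apply, hBA, Finset.sum_eq_single j]
        · simp
        · intro k _ hk
          rw [Matrix.one_apply_ne ((Fin.succAbove_right_injective).ne hk), mul_zero]
        · simp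
      have hdet : IsUnit M.det := by
        rw [hM, Matrix.det_mul]
        exact (Matrix.isUnit_det_of_right_inverse h'.mul_inv).mul
          (Matrix.isUnit_det_of_right_inverse h.inv_mul)
      rw [Matrix.det_succ_column M b, Fin.sum_univ_succAbove _ a] at hdet
      simp only [hMb, mul_zero, zero_mul, Finset.sum_const_zero, add_zero, hsub] at hdet
      exact isUnit_of_mul_isUnit_right hdet
  refine ⟨⟨Matrix.vecMul (toReal v - toReal v) (realMat C), ?_⟩,
    hc.isPolytope (hG.isPolytope hP.isPolytope), hlat, ?_, ?_⟩
  · rw [Set.mem_preimage, hc.chart_retract _ hv]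
    exact hv
  · intro y hy
    obtain ⟨y, rfl⟩ := hlat hy
    obtain ⟨z, hz, hinj, -⟩ := key y hy
    have hinj' : Function.Injective fun i => toReal (z i) := toReal_injective.comp hinj
    rw [← hz, ← Set.image_univ, Set.ncard_image_of_injective _ hinj',
      Set.ncard_univ, Nat.card_eq_fintype_card, Fintype.card_fin]
  · intro y hy
    obtain ⟨z, hz, -, hu⟩ := key y hy
    exact ⟨z, hz, Int.isUnit_iff.1 hu⟩

end Facet

/-- Every facet of a smooth polytope has a lattice chart in which it is a smooth polytope. -/
lemma IsSmooth.exists_chart {P G : Set (Fin (n + 1) → ℝ)} (hP : IsSmooth P) (hG : IsFace P G)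
    (hdim : affDim G = n) : ∃ (v : Fin (n + 1) → ℤ) (B : Matrix (Fin n) (Fin (n + 1)) ℤ)
      (C : Matrix (Fin (n + 1)) (Fin n) ℤ), IsChart G v B C ∧ IsSmooth (chart v B ⁻¹' G) := by
  obtain ⟨x, hx⟩ := (hG.isPolytope hP.isPolytope).vertices_nonempty hG.1
  rw [hG.vertices_eq] at hx
  obtain ⟨v, rfl⟩ := hP.lattice hx.2
  obtain ⟨w, A, h⟩ := hP.exists_isEdgeFrame hx.2
  obtain ⟨b, hb⟩ := h.exists_missing hP.isPolytope hG hx.1 hdim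
  have hb' : toReal (w b) ∉ G := fun hmem => (hb b).1 hmem rfl
  exact ⟨_, _, _, h.isChart hP.isPolytope hG hx.1 hb',
    h.isSmooth_preimage hP hG hdim hx.1 hb'⟩

/-! ### Counting lattice points -/

lemma IsPolytope.finite_inter_lattice {P : Set (Fin d → ℝ)} (hP : IsPolytope P) :
    (P ∩ lattice d).Finite := by
  obtain ⟨R, hR⟩ := hP.isCompact.isBounded.exists_norm_le
  have hfin : (Set.Icc (fun _ : Fin d => -⌈R⌉) (fun _ => ⌈R⌉)).Finite := Set.finite_Icc _ _
  refine (hfin.image toReal).subset ?_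
  rintro _ ⟨hx, z, rfl⟩
  have hz : ∀ i, |z i| ≤ ⌈R⌉ := fun i => by
    have h1 := (norm_le_pi_norm (toReal z) i).trans (hR _ hx)
    have h2 : ((|z i| : ℤ) : ℝ) ≤ ⌈R⌉ := by
      rw [Int.cast_abs]
      exact h1.trans (Int.le_ceil R)
    exact_mod_cast h2
  exact ⟨z, ⟨fun i => (abs_le.1 (hz i)).1, fun i => (abs_le.1 (hz i)).2⟩, rfl⟩

/-- Equal dimension forces equal direction spaces, so the functional exposing `G` is constant on
`G'` too. -/
lemma IsFace.eq_of_subset {P G G' : Set (Fin d → ℝ)} (hG : IsFace P G) (hG' : IsFace P G')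
    (hdim : affDim G = affDim G') (h : G ⊆ G') : G = G' := by
  have hspan : vectorSpan ℝ G = vectorSpan ℝ G' :=
    Submodule.eq_of_le_of_finrank_eq (vectorSpan_mono ℝ h) hdim
  obtain ⟨⟨g, hg⟩, c, rfl⟩ := isFace_iff.1 hG
  refine Set.Subset.antisymm h fun x hx => (mem_maxFace_iff hg).2 ⟨hG'.subset hx, ?_⟩
  have hmem : x - g ∈ vectorSpan ℝ (maxFace P c) := hspan ▸ vsub_mem_vectorSpan ℝ hx (h hg)
  have hle : vectorSpan ℝ (maxFace P c) ≤ LinearMap.ker (dotProductEquiv ℝ (Fin d) c) := by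
    rw [vectorSpan_def, Submodule.span_le]
    rintro _ ⟨x, hx, y, hy, rfl⟩
    change c ⬝ᵥ (x - y) = 0
    rw [dotProduct_sub, ((mem_maxFace_iff hy).1 hx).2, sub_self]
  have h0 : c ⬝ᵥ (x - g) = 0 := hle hmem
  rwa [dotProduct_sub, sub_eq_zero] at h0

/-- A functional that is maximal at an interior point vanishes. -/
lemma eq_zero_of_mem_interior {Q : Set (Fin d → ℝ)} {y u : Fin d → ℝ} (hy : y ∈ interior Q)
    (h : ∀ z ∈ Q, u ⬝ᵥ z ≤ u ⬝ᵥ y) : u = 0 := by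
  have hcont : Continuous fun ε : ℝ => y + ε • u := by fun_prop
  have ht : Filter.Tendsto (fun ε : ℝ => y + ε • u) (nhdsWithin 0 (Set.Ioi 0)) (nhds y) := by
    have := hcont.tendsto 0
    rw [zero_smul, add_zero] at this
    exact this.mono_left nhdsWithin_le_nhds
  obtain ⟨ε, hε, hpos⟩ := ((ht.eventually (mem_interior_iff_mem_nhds.1 hy)).and
    self_mem_nhdsWithin).exists
  have h1 := h _ hε
  rw [dotProduct_add, dotProduct_smul, smul_eq_mul, add_le_iff_nonpos_right] at h1
  have h2 : u ⬝ᵥ u ≤ 0 := nonpos_of_mul_nonpos_right h1 hpos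
  refine dotProduct_self_eq_zero.1 (le_antisymm h2 ?_)
  exact Finset.sum_nonneg fun i _ => mul_self_nonneg (u i)

namespace IsChart

variable {P G : Set (Fin n → ℝ)} {v : Fin n → ℤ} {B : Matrix (Fin m) (Fin n) ℤ}
  {C : Matrix (Fin n) (Fin m) ℤ}

/-- The lattice points of `G` that are interior in the chart. -/
def relInterior (G : Set (Fin n → ℝ)) (v : Fin n → ℤ) (B : Matrix (Fin m) (Fin n) ℤ) :
    Set (Fin n → ℝ) := chart v B '' (interior (chart v B ⁻¹' G) ∩ lattice m)

lemma ncard_relInterior (h : IsChart G v B C) :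
    (relInterior G v B).ncard = numLatticePoints (interior (chart v B ⁻¹' G)) :=
  Set.ncard_image_of_injective _ h.injective

lemma numLatticePoints_preimage (h : IsChart G v B C) :
    numLatticePoints (chart v B ⁻¹' G) = numLatticePoints G := by
  rw [numLatticePoints, ← Set.ncard_image_of_injective _ h.injective, numLatticePoints]
  congr 1
  have : chart v B ⁻¹' G ∩ lattice m = chart v B ⁻¹' (G ∩ lattice n) := by
    ext y
    simp only [Set.mem_inter_iff, Set.mem_preimage, h.chart_mem_lattice]
  rw [this, h.image_preimage Set.inter_subset_left]

lemma ncard_vertices_preimage (h : IsChart G v B C) :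
    (vertices (chart v B ⁻¹' G)).ncard = (vertices G).ncard := by
  rw [h.vertices_preimage, ← Set.ncard_image_of_injective _ h.injective,
    h.image_preimage (vertices_subset G)]

lemma relInterior_subset (h : IsChart G v B C) : relInterior G v B ⊆ G ∩ lattice n := by
  rintro _ ⟨y, ⟨hy, hyl⟩, rfl⟩
  exact ⟨(interior_subset hy : y ∈ chart v B ⁻¹' G), h.chart_mem_lattice.2 hyl⟩

/-- A face that meets the relative interior of a face `G` contains `G`. -/
lemma subset_of_mem_relInterior (h : IsChart G v B C) (hG : G ⊆ P) {G' : Set (Fin n → ℝ)}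
    (hG' : IsFace P G') {x : Fin n → ℝ} (hx : x ∈ relInterior G v B) (hxG' : x ∈ G') :
    G ⊆ G' := by
  obtain ⟨y, ⟨hy, -⟩, rfl⟩ := hx
  obtain ⟨-, c, rfl⟩ := isFace_iff.1 hG'
  -- Pulled back to the chart, `c` is maximal at an interior point; so it vanishes there and `c` is
  -- constant on `G`.
  have h0 : Matrix.mulVec (realMat B) c = 0 := by
    refine eq_zero_of_mem_interior hy fun z hz => ?_
    have := hxG'.2 _ (hG hz)
    rwa [dotProduct_chart, dotProduct_chart, add_le_add_iff_left] at this
  intro x hx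
  refine (mem_maxFace_iff hxG').2 ⟨hG hx, ?_⟩
  rw [← h.chart_retract x hx, dotProduct_chart, dotProduct_chart, h0, zero_dotProduct,
    zero_dotProduct]

end IsChart

lemma minInterior_le {N k : ℕ} {Q : Set (Fin 2 → ℝ)} (hQ : Q ∈ smoothPolygons N k) :
    minInterior N k ≤ numLatticePoints (interior Q) := Nat.sInf_le ⟨Q, hQ, rfl⟩

lemma minBoundary_le {N k : ℕ} {Q : Set (Fin 2 → ℝ)} (hQ : Q ∈ smoothPolygons N k) :
    minBoundary N k ≤ numLatticePoints Q - numLatticePoints (interior Q) :=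
  Nat.sInf_le ⟨Q, hQ, rfl⟩

/-- Finiteness and nonemptiness make the `sSup` an attained maximum rather than the default value
`0`. -/
lemma exists_rayDegree_eq_maxRayDegree {F : Set (Set (Fin d → ℝ))} (hF : F.Finite)
    (hne : (conesOfDim F 1).Nonempty) : ∃ r ∈ conesOfDim F 1, rayDegree F r = maxRayDegree F := by
  have hfin : (conesOfDim F 1).Finite := hF.subset fun C hC => hC.1
  exact Nat.sSup_mem (hne.image _) (hfin.image _).bddAbove

/-- The lattice points of a smooth polytope are counted from below by the vertices, the
relative interiors of the facets, and the other boundary points of one facet. -/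
lemma vertices_add_boundary_add_sum_relInterior_le {P : Set (Fin 3 → ℝ)} (hP : IsSmooth P)
    (v : Set (Fin 3 → ℝ) → Fin 3 → ℤ)
    (B : Set (Fin 3 → ℝ) → Matrix (Fin 2) (Fin 3) ℤ)
    (C : Set (Fin 3 → ℝ) → Matrix (Fin 3) (Fin 2) ℤ)
    (hch : ∀ G, IsFace P G ∧ affDim G = 2 → IsChart G (v G) (B G) (C G))
    {G₀ : Set (Fin 3 → ℝ)} (hG₀ : IsFace P G₀ ∧ affDim G₀ = 2) :
    (vertices P).ncard + (numLatticePoints G₀ - (IsChart.relInterior G₀ (v G₀) (B G₀)).ncard -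
      (vertices G₀).ncard) +
      ∑ᶠ G ∈ {G | IsFace P G ∧ affDim G = 2}, (IsChart.relInterior G (v G) (B G)).ncard ≤
      numLatticePoints P := by
  set I : Set (Fin 3 → ℝ) → Set (Fin 3 → ℝ) := fun G => IsChart.relInterior G (v G) (B G) with hI
  set 𝓕 := {G | IsFace P G ∧ affDim G = 2} with h𝓕
  have hfin : (P ∩ lattice 3).Finite := hP.isPolytope.finite_inter_lattice
  have h𝓕fin : 𝓕.Finite := hP.isPolytope.finite_faces.subset fun G hG => hG.1
  have hIsub : ∀ G ∈ 𝓕, I G ⊆ P ∩ lattice 3 := fun G hG =>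
    (hch G hG).relInterior_subset.trans (Set.inter_subset_inter_left _ hG.1.subset)
  have huniq : ∀ G ∈ 𝓕, ∀ G' ∈ 𝓕, ∀ x ∈ I G, x ∈ G' → G = G' := fun G hG G' hG' x hx hx' =>
    hG.1.eq_of_subset hG'.1 (hG.2.trans hG'.2.symm)
      ((hch G hG).subset_of_mem_relInterior hG.1.subset hG'.1 hx hx')
  have hvert : ∀ G ∈ 𝓕, ∀ x ∈ I G, x ∉ vertices P := by
    intro G hG x hx hxP
    have := (hch G hG).subset_of_mem_relInterior hG.1.subset
      (hP.isPolytope.isFace_singleton hxP) hx rfl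
    have h0 := affDim_eq_zero_iff.2 (Set.subsingleton_singleton.anti this)
    rw [hG.2] at h0
    exact two_ne_zero h0
  have hdisj : 𝓕.PairwiseDisjoint I := by
    intro G hG G' hG' hne
    refine Set.disjoint_left.2 fun x hx hx' => hne ?_
    exact huniq G hG G' hG' x hx ((hch G' hG').relInterior_subset hx').1
  -- Only one facet contributes its boundary, since neighbouring facets share boundary points.
  set D := ((G₀ ∩ lattice 3) \ I G₀) \ vertices G₀ with hD
  have hG₀fin : (G₀ ∩ lattice 3).Finite :=
    hfin.subset (Set.inter_subset_inter_left _ hG₀.1.subset)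
  have hVG₀ : vertices G₀ ⊆ (G₀ ∩ lattice 3) \ I G₀ := by
    intro x hx
    rw [hG₀.1.vertices_eq] at hx
    exact ⟨⟨hx.1, hP.lattice hx.2⟩, fun hxI => hvert G₀ hG₀ x hxI hx.2⟩
  have hDcard : D.ncard = numLatticePoints G₀ - (I G₀).ncard - (vertices G₀).ncard := by
    rw [hD, Set.ncard_sdiff hVG₀ (hG₀.1.isPolytope hP.isPolytope).finite_vertices,
      Set.ncard_sdiff (hch G₀ hG₀).relInterior_subset
        (hG₀fin.subset (hch G₀ hG₀).relInterior_subset), numLatticePoints]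
  have hDsub : D ⊆ P ∩ lattice 3 := fun x hx => ⟨hG₀.1.subset hx.1.1.1, hx.1.1.2⟩
  have hVsub : vertices P ⊆ P ∩ lattice 3 := fun x hx => ⟨vertices_subset P hx, hP.lattice hx⟩
  have hUsub : (⋃ G ∈ 𝓕, I G) ⊆ P ∩ lattice 3 := Set.iUnion₂_subset hIsub
  have hVD : Disjoint (vertices P) D := Set.disjoint_left.2 fun x hx hxD =>
    hxD.2 (hG₀.1.vertices_eq ▸ ⟨hxD.1.1.1, hx⟩)
  have hVDU : Disjoint (vertices P ∪ D) (⋃ G ∈ 𝓕, I G) := by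
    refine Set.disjoint_left.2 fun x hx hxU => ?_
    obtain ⟨G, hG, hxG⟩ := Set.mem_iUnion₂.1 hxU
    rcases hx with hx | hx
    · exact hvert G hG x hxG hx
    · have := huniq G hG G₀ hG₀ x hxG hx.1.1.1
      subst this
      exact hx.1.2 hxG
  rw [← hDcard, ← h𝓕fin.ncard_biUnion (fun G hG => hfin.subset (hIsub G hG)) hdisj,
    ← Set.ncard_union_eq hVD (hfin.subset hVsub) (hfin.subset hDsub),
    ← Set.ncard_union_eq hVDU (hfin.subset (Set.union_subset hVsub hDsub)) (hfin.subset hUsub)]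
  exact Set.ncard_le_ncard (Set.union_subset (Set.union_subset hVsub hDsub) hUsub) hfin

end LatticePolytope
open LatticePolytope

theorem mainTheorem9 (P : Set (Fin 3 → ℝ)) (hP : LatticePolytope.IsSmooth P) (N : ℕ)
    (hN : ∀ G : Set (Fin 3 → ℝ), LatticePolytope.IsFace P G → LatticePolytope.affDim G = 2 →
      LatticePolytope.numLatticePoints G ≤ N) :
    (LatticePolytope.normalFan P).Finite ∧
    (LatticePolytope.conesOfDim (LatticePolytope.normalFan P) 1).Nonempty ∧
    (∀ r ∈ LatticePolytope.conesOfDim (LatticePolytope.normalFan P) 1,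
      (LatticePolytope.smoothPolygons N
        (LatticePolytope.rayDegree (LatticePolytope.normalFan P) r)).Nonempty) ∧
    ((LatticePolytope.conesOfDim (LatticePolytope.normalFan P) 3).ncard : ℤ)
      + ((LatticePolytope.minBoundary N
            (LatticePolytope.maxRayDegree (LatticePolytope.normalFan P)) : ℤ)
          - (LatticePolytope.maxRayDegree (LatticePolytope.normalFan P) : ℤ))
      + ∑ᶠ r ∈ LatticePolytope.conesOfDim (LatticePolytope.normalFan P) 1,
          (LatticePolytope.minInterior N
            (LatticePolytope.rayDegree (LatticePolytope.normalFan P) r) : ℤ)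
      ≤ (LatticePolytope.numLatticePoints P : ℤ) := by

  have hpoly := hP.isPolytope
  have hFfin := hpoly.finite_normalFan
  have hrays : conesOfDim (normalFan P) 1 =
      normalCone P '' {G | IsFace P G ∧ affDim G = 2} := conesOfDim_normalFan hpoly rfl
  have hinj : Set.InjOn (normalCone P) {G | IsFace P G ∧ affDim G = 2} :=
    (injOn_normalCone P).mono fun G hG => hG.1
  have hfacet : {G | IsFace P G ∧ affDim G = 2}.Nonempty := by
    obtain ⟨x, hx⟩ := hpoly.vertices_nonempty hP.nonempty
    obtain ⟨v, rfl⟩ := hP.lattice hx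
    obtain ⟨w, A, h⟩ := hP.exists_isEdgeFrame hx
    exact h.exists_facet hpoly
  have hne : (conesOfDim (normalFan P) 1).Nonempty := hrays ▸ hfacet.image _
  choose! v B C hch hsm using fun (G : Set (Fin 3 → ℝ)) (hG : IsFace P G ∧ affDim G = 2) =>
    hP.exists_chart hG.1 hG.2
  have hmem : ∀ G, IsFace P G ∧ affDim G = 2 → chart (v G) (B G) ⁻¹' G ∈
      smoothPolygons N (rayDegree (normalFan P) (normalCone P G)) := fun G hG =>
    ⟨hsm G hG, by rw [(hch G hG).ncard_vertices_preimage, rayDegree_normalCone hpoly hG.1],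
      by rw [(hch G hG).numLatticePoints_preimage]; exact hN G hG.1 hG.2⟩
  refine ⟨hFfin, hne, ?_, ?_⟩
  · rw [hrays]
    rintro _ ⟨G, hG, rfl⟩
    exact ⟨_, hmem G hG⟩
  obtain ⟨r, hr, hmax⟩ := exists_rayDegree_eq_maxRayDegree hFfin hne
  rw [hrays] at hr
  obtain ⟨G₀, hG₀, rfl⟩ := hr
  have hcount := vertices_add_boundary_add_sum_relInterior_le hP v B C hch hG₀
  have hb := minBoundary_le (hmem G₀ hG₀)
  rw [hmax, (hch G₀ hG₀).numLatticePoints_preimage, ← (hch G₀ hG₀).ncard_relInterior] at hb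
  rw [rayDegree_normalCone hpoly hG₀.1] at hmax
  have hfin : {G | IsFace P G ∧ affDim G = 2}.Finite :=
    hpoly.finite_faces.subset fun G hG => hG.1
  have hsum : (∑ᶠ r ∈ conesOfDim (normalFan P) 1,
        (minInterior N (rayDegree (normalFan P) r) : ℤ)) ≤
      ((∑ᶠ G ∈ {G | IsFace P G ∧ affDim G = 2},
        (IsChart.relInterior G (v G) (B G)).ncard : ℕ) : ℤ) := by
    rw [hrays, finsum_mem_image hinj, finsum_mem_eq_finite_toFinset_sum _ hfin,
      finsum_mem_eq_finite_toFinset_sum _ hfin, Nat.cast_sum]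
    refine Finset.sum_le_sum fun G hG => ?_
    have hG' := hfin.mem_toFinset.1 hG
    rw [(hch G hG').ncard_relInterior]
    exact_mod_cast minInterior_le (hmem G hG')
  rw [ncard_conesOfDim_top hpoly]
  rw [hmax] at hcount
  -- Truncated subtraction dominates integer subtraction, so the count bounds `minBoundary -
  -- maxRayDegree` whatever its sign.
  omega
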